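/- Let $n\ge 0$ be an integer, $\kappa\in\mathbb C$ with $\operatorname{Re}\kappa<\tfrac12$, and $-1<x<1$. Let $$C_n^{\lambda}(t)=\sum_{k=0}^{\lfloor n/2\rfloor}\frac{(-1)^k(\lambda)_{n-k}}{k!\,(n-2k)!}(2t)^{n-2k}$$ be the Gegenbauer polynomial with parameter $\lambda\in\mathbb C$, where $(\lambda)_m=\lambda(\lambda+1)\cdots(\lambda+m-1)$, and let $$P_\nu^\mu(x)=\Big(\frac{1+x}{1-x}\Big)^{\mu/2}\,\sum_{k=0}^{\infty}\frac{(-\nu)_k(\nu+1)_k}{k!\,\Gamma(1-\mu+k)}\Big(\frac{1-x}{2}\Big)^k$$ (with $1/\Gamma=0$ at the poles of $\Gamma$) be the Ferrers function of the first kind, i.e. the associated Legendre function of the first kind on the cut $(-1,1)$. Powers of positive numbers are principal. (i) For every $\lambda\in\mathbb C$ with $\operatorname{Re}\lambda>-\tfrac12$ and $\lambda\ne0$, the following integral converges absolutely, and $$\frac{n+\lambda}{\lambda}\int_x^1(1-t^2)^{\lambda-1/2}(t-x)^{-\kappa-1/2}C_n^\lambda(t)\,dt=\frac{\sqrt\pi\,(n+\lambda)\,\Gamma(n+2\lambda)\,\Gamma(\tfrac12-\kappa)}{2^{\lambda-1/2}\,n!\,\Gamma(\lambda+1)}\,(1-x^2)^{(\lambda-\kappa)/2}\,P_{n+\lambda-1/2}^{\kappa-\lambda}(x).$$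 (ii) The formula remains true for $\lambda=0$ if the factors that are then undefined are read as limits: with $T_n$ the Chebyshev polynomial of the first kind, $\varepsilon_0=1$ and $\varepsilon_n=2$ for $n\ge1$, one has $$\lim_{\lambda\to0}\frac{n+\lambda}{\lambda}C_n^\lambda(t)=\varepsilon_nT_n(t)\quad(t\in\mathbb R),\qquad \lim_{\lambda\to0}\frac{(n+\lambda)\Gamma(n+2\lambda)}{n!\,\Gamma(\lambda+1)}=\frac{\varepsilon_n}{2},$$ where $\lambda\to0$ through nonzero complex values, and, the integral converging absolutely, $$\int_x^1(1-t^2)^{-1/2}(t-x)^{-\kappa-1/2}\,\varepsilon_nT_n(t)\,dt=\frac{\sqrt\pi\,\varepsilon_n\,\Gamma(\tfrac12-\kappa)}{2\cdot 2^{-1/2}}\,(1-x^2)^{-\kappa/2}\,P_{n-1/2}^{\kappa}(x).$$ -/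

import Mathlib

open Filter Topology MeasureTheory

/-- The Gegenbauer (ultraspherical) polynomial `C_n^lam(t)` of degree `n` with complex
parameter `lam`,
`C_n^lam(t) = ∑_{k ≤ n/2} (-1)^k (lam)_{n-k} / (k! (n-2k)!) (2t)^(n-2k)`,
where `(lam)_m` is the rising factorial. -/
noncomputable def gegenbauerC (n : ℕ) (lam t : ℂ) : ℂ :=
  ∑ k ∈ Finset.range (n / 2 + 1),
    (-1 : ℂ) ^ k * (ascPochhammer ℂ (n - k)).eval lam /
      ((Nat.factorial k : ℂ) * (Nat.factorial (n - 2 * k) : ℂ)) * (2 * t) ^ (n - 2 * k)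

/-- The Ferrers function of the first kind (the associated Legendre function of the first kind on
the cut `-1 < x < 1`) of degree `ν` and order `μ`,
`P_ν^μ(x) = ((1+x)/(1-x))^(μ/2) · ₂F₁(-ν, ν+1; 1-μ; (1-x)/2) / Γ(1-μ)`.
The quotient `₂F₁ / Γ(1-μ)` is the regularized hypergeometric function, so that the definition
is also the right one when `μ` is a positive integer. -/
noncomputable def ferrersP (ν μ : ℂ) (x : ℝ) : ℂ :=
  (((1 + x) / (1 - x) : ℝ) : ℂ) ^ (μ / 2) *
    Complex.regularizedGaussHGFun (-ν) (ν + 1) (1 - μ) (((1 - x) / 2 : ℝ) : ℂ)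

/-- The function `(1 - t²)^(lam - 1/2) (t - x)^(-κ - 1/2)` of `t ∈ (x, 1)`; both bases are
positive there, so that the powers are the principal ones. -/
noncomputable def cutWeight (lam κ : ℂ) (x t : ℝ) : ℂ :=
  ((1 - t ^ 2 : ℝ) : ℂ) ^ (lam - 1 / 2) * ((t - x : ℝ) : ℂ) ^ (-κ - 1 / 2)

/-! With `t = 1 - 2u` and `x = 1 - 2y` the integral becomes a Riemann–Liouville integral over `0 < u
< y`. Write `c = λ + 1/2`, `s = 1/2 - κ`, and let `p n` be the Gegenbauer polynomial scaled to be
one at `t = 1`. The weight supplies `u^(c-1) (y-u)^(s-1)` and a leftover `(1-u)^(λ-1/2)`, and `p n *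
(1-u)^(λ-1/2)` is `Γ(c)` times the regularized `₂F₁(c+n, 1-c-n; c; u)`
(`mul_cpow_eq_regularizedGaussHGFun`). Bateman's integral then replaces the lower parameter `c` by
`c + s = 1 - (κ - λ)`, which is the hypergeometric factor of the Ferrers function.

The hypergeometric form of `p n` comes by induction: the binomial series starts it, and contiguous
relations match the three-term recurrence. Only the recurrence and the initial values are used, so
`integral_cutWeight_mul` serves both `p n = n!/(2λ)_n C_n^λ` for `λ ≠ 0` and `p n = T_n` for `λ =
0`. The formula at `λ = 0` is thus proved directly, with no limit taken under the integral; the two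
limits are separate computations. -/

/-! ### Hypergeometric series and contiguous relations -/

theorem hasSum_regularizedGaussHGFun (a b c : ℂ) {z : ℂ} (hz : ‖z‖ < 1) :
    HasSum (fun k : ℕ => (ascPochhammer ℂ k).eval a * (ascPochhammer ℂ k).eval b /
      ((Nat.factorial k : ℂ) * Complex.Gamma (c + k)) * z ^ k)
      (Complex.regularizedGaussHGFun a b c z) := by
  have hz' : z ∈ Metric.eball (0 : ℂ) (Complex.regularizedGaussHGFunSeries a b c).radius := by
    refine Metric.eball_subset_eball (Complex.radius_regularizedGaussHGFunSeries_ge_one a b c) ?_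
    rwa [Metric.mem_eball, edist_zero_right, ← ENNReal.ofReal_one, ← ofReal_norm,
      ENNReal.ofReal_lt_ofReal_iff one_pos]
  refine ((Complex.regularizedGaussHGFunSeries a b c).hasSum hz').congr_fun ?_
  intro k
  rw [FormalMultilinearSeries.apply_eq_pow_smul_coeff,
    Complex.coeff_regularizedGaussHGFunSeries, smul_eq_mul, mul_comm]

/-- Since `Γ(c) (c)_k = Γ(c + k)`, the series collapses to the binomial series. -/
theorem regularizedGaussHGFun_self {b c z : ℂ} (hc : 0 < c.re) (hz : ‖z‖ < 1) :
    Complex.Gamma c * Complex.regularizedGaussHGFun c b c z = (1 - z) ^ (-b) := by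
  have h1 := (hasSum_regularizedGaussHGFun c b c hz).mul_left (Complex.Gamma c)
  have h2 := (Complex.one_div_one_sub_cpow_hasFPowerSeriesOnBall_zero b).hasSum
    (y := z) (by
      rwa [Metric.mem_eball, edist_zero_right, ← ENNReal.ofReal_one, ← ofReal_norm,
        ENNReal.ofReal_lt_ofReal_iff one_pos])
  rw [zero_add, one_div, ← Complex.cpow_neg] at h2
  refine h1.unique (h2.congr_fun fun k => ?_)
  have hG : Complex.Gamma (c + k) ≠ 0 := Complex.Gamma_ne_zero_of_re_pos (by simp; positivity)
  have hG0 : Complex.Gamma c ≠ 0 := Complex.Gamma_ne_zero_of_re_pos hc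
  have hck : ∀ m : ℕ, c ≠ -m := by
    rintro m rfl
    simp at hc
    linarith [(Nat.cast_nonneg m : (0 : ℝ) ≤ m)]
  have e : Complex.Gamma c * (ascPochhammer ℂ k).eval c = Complex.Gamma (c + k) := by
    rw [← Complex.Gamma_add_nat_div_Gamma_eq c hck]; field_simp
  have e2 : Ring.choose (b + k - 1) k = (ascPochhammer ℂ k).eval b / (Nat.factorial k : ℂ) := by
    have hk : (Nat.factorial k : ℂ) ≠ 0 := by exact_mod_cast k.factorial_ne_zero
    rw [eq_div_iff hk, mul_comm, ← nsmul_eq_mul, ← Ring.multichoose_eq,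
      Ring.factorial_nsmul_multichoose_eq_ascPochhammer, Polynomial.ascPochhammer_smeval_eq_eval]
  rw [FormalMultilinearSeries.ofScalars_apply_eq, e2, smul_eq_mul]
  have hk : (Nat.factorial k : ℂ) ≠ 0 := by exact_mod_cast k.factorial_ne_zero
  rw [← e] at hG ⊢
  have := right_ne_zero_of_mul hG
  field_simp

theorem ascPochhammer_eval_add_one_mul (a : ℂ) (k : ℕ) :
    (ascPochhammer ℂ (k + 1)).eval a = a * (ascPochhammer ℂ k).eval (a + 1) := by
  simp [ascPochhammer_succ_left]

theorem ascPochhammer_eval_add_one (a : ℂ) (k : ℕ) :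
    a * (ascPochhammer ℂ k).eval (a + 1) = (ascPochhammer ℂ k).eval a * (a + k) := by
  rw [← ascPochhammer_eval_add_one_mul, ascPochhammer_succ_eval]

/-- The contiguous relation that corresponds to the recurrence of the Gegenbauer polynomials. -/
theorem regularizedGaussHGFun_contiguous {c m z : ℂ} (hc : 0 < c.re) (hz : ‖z‖ < 1)
    (h0 : c + m ≠ 0) (h1 : c + m + 1 ≠ 0) :
    (m + 2 * c) * Complex.regularizedGaussHGFun (c + m + 2) (-1 - c - m) c z =
      (2 * m + 2 * c + 1) * (1 - 2 * z) * Complex.regularizedGaussHGFun (c + m + 1) (-c - m) c z -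
        (m + 1) * Complex.regularizedGaussHGFun (c + m) (1 - c - m) c z := by
  set F := Complex.regularizedGaussHGFun (c + m + 1) (-c - m) c z with hF
  have s1 := hasSum_regularizedGaussHGFun (c + m + 1) (-c - m) c hz
  have s0 := (hasSum_regularizedGaussHGFun (c + m) (1 - c - m) c hz).mul_left (m + 1)
  have s2 := (hasSum_regularizedGaussHGFun (c + m + 2) (-1 - c - m) c hz).mul_left (m + 2 * c)
  have s3 := s1.mul_left (2 * m + 2 * c + 1)
  have s4 := s1.mul_left (2 * (2 * m + 2 * c + 1) * z)
  rw [← hF] at s3 s4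
  -- The series `s4` carries an extra factor `z`, so its term `k` matches term `k + 1` of the
  -- others.
  rw [← hasSum_nat_add_iff' 1] at s3 s0 s2
  simp only [Finset.sum_range_one] at s3 s0 s2
  have := (s3.sub s4).sub s0
  have key := s2.unique (this.congr_fun fun k => ?_)
  · simp only [pow_zero, ascPochhammer_zero, Polynomial.eval_one, Nat.factorial_zero, Nat.cast_zero,
      add_zero, Nat.cast_one, one_mul, mul_one] at key
    linear_combination key
  · have hk : (Nat.factorial k : ℂ) ≠ 0 := by exact_mod_cast k.factorial_ne_zero
    have hk1 : (k : ℂ) + 1 ≠ 0 := by exact_mod_cast k.succ_ne_zero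
    have hck : c + k ≠ 0 := fun h => by
      have := congrArg Complex.re h
      simp at this
      linarith [(Nat.cast_nonneg k : (0 : ℝ) ≤ k)]
    have hG : Complex.Gamma (c + k) ≠ 0 := Complex.Gamma_ne_zero_of_re_pos (by simp; positivity)
    have eG : Complex.Gamma (c + (k + 1 : ℕ)) = (c + k) * Complex.Gamma (c + k) := by
      rw [← Complex.Gamma_add_one _ hck]; push_cast; ring_nf
    -- All six Pochhammer symbols are rational multiples of `X` or `Y`; `h0` and `h1` allow the
    -- divisions.
    set X := (ascPochhammer ℂ k).eval (c + m + 1)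
    set Y := (ascPochhammer ℂ k).eval (-c - m) with hY
    have x0 : (ascPochhammer ℂ (k + 1)).eval (c + m) = (c + m) * X :=
      ascPochhammer_eval_add_one_mul _ _
    have x1 : (ascPochhammer ℂ (k + 1)).eval (c + m + 1) = X * (c + m + 1 + k) :=
      ascPochhammer_succ_eval _ _
    have x2 : (ascPochhammer ℂ (k + 1)).eval (c + m + 2) =
        X * (c + m + 1 + k) * (c + m + 2 + k) / (c + m + 1) := by
      rw [eq_div_iff h1, ascPochhammer_succ_eval, mul_right_comm, mul_comm _ (c + m + 1)]
      have := ascPochhammer_eval_add_one (c + m + 1) k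
      rw [show c + m + 1 + 1 = c + m + 2 by ring] at this
      rw [this]
    have y2 : (ascPochhammer ℂ (k + 1)).eval (-1 - c - m) = (-1 - c - m) * Y := by
      rw [ascPochhammer_eval_add_one_mul, hY]; ring_nf
    have y1 : (ascPochhammer ℂ (k + 1)).eval (-c - m) = Y * (-c - m + k) :=
      ascPochhammer_succ_eval _ _
    have y0 : (ascPochhammer ℂ (k + 1)).eval (1 - c - m) =
        -(Y * (-c - m + k) * (1 - c - m + k) / (c + m)) := by
      rw [← neg_div, eq_div_iff h0, ascPochhammer_succ_eval]
      have := ascPochhammer_eval_add_one (-c - m) k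
      rw [show -c - m + 1 = 1 - c - m by ring] at this
      linear_combination (-(1 - c - m + k)) * this
    rw [x0, x1, x2, y0, y1, y2, eG, Nat.factorial_succ]
    push_cast
    field_simp
    ring

/-- Formally the contiguous relation at `m = -1` divided by `2c - 1`. That factor is `2λ` in the
application and vanishes at `λ = 0`, hence a separate comparison of coefficients. -/
theorem regularizedGaussHGFun_contiguous_zero {c z : ℂ} (hc : 0 < c.re) (hz : ‖z‖ < 1) :
    Complex.regularizedGaussHGFun (c + 1) (-c) c z =
      (1 - 2 * z) * Complex.regularizedGaussHGFun c (1 - c) c z := by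
  set F := Complex.regularizedGaussHGFun c (1 - c) c z with hF
  have s0 := hasSum_regularizedGaussHGFun c (1 - c) c hz
  have s1 := hasSum_regularizedGaussHGFun (c + 1) (-c) c hz
  have s4 := s0.mul_left (2 * z)
  rw [← hF] at s0 s4
  rw [← hasSum_nat_add_iff' 1] at s1 s0
  simp only [Finset.sum_range_one] at s1 s0
  have key := s1.unique ((s0.sub s4).congr_fun fun k => ?_)
  · simp only [pow_zero, ascPochhammer_zero, Polynomial.eval_one, Nat.factorial_zero, Nat.cast_zero,
      add_zero, Nat.cast_one, one_mul, mul_one] at key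
    linear_combination key
  · have hk : (Nat.factorial k : ℂ) ≠ 0 := by exact_mod_cast k.factorial_ne_zero
    have hk1 : (k : ℂ) + 1 ≠ 0 := by exact_mod_cast k.succ_ne_zero
    have hc0 : c ≠ 0 := by rintro rfl; simp at hc
    have hck : c + k ≠ 0 := fun h => by
      have := congrArg Complex.re h
      simp at this
      linarith [(Nat.cast_nonneg k : (0 : ℝ) ≤ k)]
    have hG : Complex.Gamma (c + k) ≠ 0 := Complex.Gamma_ne_zero_of_re_pos (by simp; positivity)
    have eG : Complex.Gamma (c + (k + 1 : ℕ)) = (c + k) * Complex.Gamma (c + k) := by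
      rw [← Complex.Gamma_add_one _ hck]; push_cast; ring_nf
    have x1 : (ascPochhammer ℂ (k + 1)).eval (c + 1) =
        (ascPochhammer ℂ k).eval c * (c + k) * (c + 1 + k) / c := by
      rw [eq_div_iff hc0, ascPochhammer_succ_eval, mul_right_comm, mul_comm _ c,
        ascPochhammer_eval_add_one]
    have y1 : (ascPochhammer ℂ (k + 1)).eval (-c) = -c * (ascPochhammer ℂ k).eval (1 - c) := by
      rw [ascPochhammer_eval_add_one_mul]; ring_nf
    rw [x1, y1, eG, Nat.factorial_succ, ascPochhammer_succ_eval, ascPochhammer_succ_eval]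
    push_cast
    field_simp
    ring

/-- A sequence with the initial values and the recurrence of the Gegenbauer polynomials normalized
by the value one at the point one is a multiple of hypergeometric functions. -/
theorem mul_cpow_eq_regularizedGaussHGFun {lam z : ℂ} (hlam : -(1 / 2) < lam.re) (hz : ‖z‖ < 1)
    (p : ℕ → ℂ) (hp0 : p 0 = 1) (hp1 : p 1 = 1 - 2 * z)
    (hp : ∀ n : ℕ, (n + 1 + 2 * lam) * p (n + 2) =
      2 * (n + 1 + lam) * (1 - 2 * z) * p (n + 1) - (n + 1) * p n) (n : ℕ) :
    p n * (1 - z) ^ (lam - 1 / 2) = Complex.Gamma (lam + 1 / 2) *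
      Complex.regularizedGaussHGFun (lam + 1 / 2 + n) (1 / 2 - lam - n) (lam + 1 / 2) z := by
  have hc : 0 < (lam + 1 / 2).re := by simp at hlam ⊢; linarith
  have hre : ∀ m : ℕ, lam + 1 / 2 + m ≠ 0 := fun m h => by
    have := congrArg Complex.re h
    simp at this hc
    linarith [(Nat.cast_nonneg m : (0 : ℝ) ≤ m)]
  have base : (1 - z) ^ (lam - 1 / 2) = Complex.Gamma (lam + 1 / 2) *
      Complex.regularizedGaussHGFun (lam + 1 / 2) (1 / 2 - lam) (lam + 1 / 2) z := by
    rw [regularizedGaussHGFun_self hc hz]; ring_nf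
  induction n using Nat.twoStepInduction with
  | zero => rw [hp0, base, Nat.cast_zero, add_zero, sub_zero, one_mul]
  | one =>
    have := regularizedGaussHGFun_contiguous_zero hc hz
    rw [show -(lam + 1 / 2) = 1 / 2 - lam - (1 : ℕ) by push_cast; ring,
      show 1 - (lam + 1 / 2) = 1 / 2 - lam by ring] at this
    rw [hp1, base, Nat.cast_one] at *
    rw [this]; ring
  | more n h0 h1 =>
    have := regularizedGaussHGFun_contiguous hc hz (hre n) (by simpa [add_assoc] using hre (n + 1))
    rw [show -1 - (lam + 1 / 2) - n = 1 / 2 - lam - (n + 2 : ℕ) by push_cast; ring,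
      show -(lam + 1 / 2) - n = 1 / 2 - lam - (n + 1 : ℕ) by push_cast; ring,
      show 1 - (lam + 1 / 2) - n = 1 / 2 - lam - n by ring,
      show lam + 1 / 2 + n + 2 = lam + 1 / 2 + (n + 2 : ℕ) by push_cast; ring,
      show lam + 1 / 2 + n + 1 = lam + 1 / 2 + (n + 1 : ℕ) by push_cast; ring] at this
    -- `Re λ > -1/2` keeps the leading coefficient nonzero, so the recurrence determines `p (n +
    -- 2)`.
    have hne : (n + 1 + 2 * lam : ℂ) ≠ 0 := fun h => by
      have := congrArg Complex.re h
      simp at this hlam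
      linarith [(Nat.cast_nonneg n : (0 : ℝ) ≤ n)]
    refine mul_left_cancel₀ hne ?_
    rw [← mul_assoc, hp]
    linear_combination (2 * (n + 1 + lam) * (1 - 2 * z)) * h1 - (n + 1) * h0 -
      Complex.Gamma (lam + 1 / 2) * this

/-! ### Beta integrals and Bateman's fractional integral -/

theorem intervalIntegrable_cpow_mul_sub_cpow {c s : ℂ} (hc : 0 < c.re) (hs : 0 < s.re) {y : ℝ}
    (hy : 0 < y) :
    IntervalIntegrable (fun u : ℝ => (u : ℂ) ^ (c - 1) * ((y : ℂ) - u) ^ (s - 1)) volume 0 y := by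
  have h := (Complex.betaIntegral_convergent hc hs).comp_mul_left (c := y⁻¹)
  rw [zero_div, one_div, inv_inv] at h
  refine (h.const_mul ((y : ℂ) ^ (c - 1) * (y : ℂ) ^ (s - 1))).congr_uIoo fun u hu => ?_
  rw [Set.uIoo_of_le hy.le] at hu
  have hyc : (y : ℂ) ≠ 0 := by exact_mod_cast hy.ne'
  have e1 : (u : ℂ) ^ (c - 1) = (y : ℂ) ^ (c - 1) * ((y⁻¹ * u : ℝ) : ℂ) ^ (c - 1) := by
    rw [← Complex.mul_cpow_ofReal_nonneg hy.le (by have := hu.1; positivity)]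
    congr 1; push_cast; field_simp
  have h1 : 0 ≤ 1 - y⁻¹ * u := by
    rw [sub_nonneg, inv_mul_le_iff₀ hy]; linarith [hu.2]
  have e2 : ((y : ℂ) - u) ^ (s - 1) =
      (y : ℂ) ^ (s - 1) * (1 - ((y⁻¹ * u : ℝ) : ℂ)) ^ (s - 1) := by
    rw [show 1 - ((y⁻¹ * u : ℝ) : ℂ) = ((1 - y⁻¹ * u : ℝ) : ℂ) by push_cast; ring,
      ← Complex.mul_cpow_ofReal_nonneg hy.le h1]
    congr 1; push_cast; field_simp
  rw [e1, e2]; ring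

/-- A scaled beta integral `B(c + k, s)`. In the termwise integration its `Γ(c + k)` cancels the one
in the series and leaves `Γ(c + s + k)`. -/
theorem integral_cpow_mul_sub_cpow_mul_pow {c s : ℂ} (hc : 0 < c.re) (hs : 0 < s.re) {y : ℝ}
    (hy : 0 < y) (k : ℕ) :
    ∫ u : ℝ in 0..y, (u : ℂ) ^ (c - 1) * ((y : ℂ) - u) ^ (s - 1) * (u : ℂ) ^ k =
      (y : ℂ) ^ (c + s - 1) * (y : ℂ) ^ k *
        (Complex.Gamma (c + k) * Complex.Gamma s / Complex.Gamma (c + s + k)) := by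
  have hyc : (y : ℂ) ≠ 0 := by exact_mod_cast hy.ne'
  have hck : 0 < (c + k).re := by simp; positivity
  have h := Complex.betaIntegral_scaled (c + k) s hy
  rw [Complex.betaIntegral_eq_Gamma_mul_div _ _ hck hs,
    show c + k + s - 1 = c + s - 1 + k by ring, show c + k + s = c + s + k by ring,
    Complex.cpow_add _ _ hyc, Complex.cpow_natCast] at h
  rw [← h]
  refine intervalIntegral.integral_congr_Ioo_of_le hy.le fun u hu => ?_
  have huc : (u : ℂ) ≠ 0 := by exact_mod_cast hu.1.ne'
  rw [show c + k - 1 = c - 1 + k by ring, Complex.cpow_add _ _ huc, Complex.cpow_natCast]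
  ring

/-- Bateman's fractional integral of the hypergeometric function. -/
theorem integral_cpow_mul_regularizedGaussHGFun (a b : ℂ) {c s : ℂ} (hc : 0 < c.re)
    (hs : 0 < s.re) {y : ℝ} (hy : 0 < y) (hy1 : y < 1) :
    ∫ u : ℝ in 0..y, (u : ℂ) ^ (c - 1) * ((y : ℂ) - u) ^ (s - 1) *
        Complex.regularizedGaussHGFun a b c u =
      Complex.Gamma s * (y : ℂ) ^ (c + s - 1) * Complex.regularizedGaussHGFun a b (c + s) y := by
  have hyn : ‖(y : ℂ)‖ < 1 := by rwa [Complex.norm_real, Real.norm_of_nonneg hy.le]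
  have hw := intervalIntegrable_cpow_mul_sub_cpow hc hs hy
  set w : ℝ → ℂ := fun u => (u : ℂ) ^ (c - 1) * ((y : ℂ) - u) ^ (s - 1)
  set C : ℂ → ℕ → ℂ := fun d k => (ascPochhammer ℂ k).eval a * (ascPochhammer ℂ k).eval b /
      ((Nat.factorial k : ℂ) * Complex.Gamma (d + k)) with hC
  have hsum := (hasSum_regularizedGaussHGFun a b c hyn).summable.norm
  have hmem : ∀ u ∈ Set.uIoc 0 y, 0 < u ∧ u ≤ y := fun u hu => by
    rwa [Set.uIoc_of_le hy.le] at hu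
  have key := intervalIntegral.hasSum_integral_of_dominated_convergence (μ := volume) (a := 0)
    (b := y) (F := fun k u => w u * (C c k * (u : ℂ) ^ k))
    (f := fun u : ℝ => w u * Complex.regularizedGaussHGFun a b c u)
    -- Each term is bounded by its value at `u = y`, where the series converges absolutely because
    -- `y < 1`.
    (fun k u => ‖w u‖ * ‖C c k * (y : ℂ) ^ k‖) ?_ ?_ ?_ ?_ ?_
  · refine key.unique ?_
    have h2 := (hasSum_regularizedGaussHGFun a b (c + s) hyn).mul_left
      (Complex.Gamma s * (y : ℂ) ^ (c + s - 1))
    refine h2.congr_fun fun k => ?_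
    have hG : Complex.Gamma (c + k) ≠ 0 := Complex.Gamma_ne_zero_of_re_pos (by simp; positivity)
    have : ∀ u : ℝ, w u * (C c k * (u : ℂ) ^ k) = C c k * (w u * (u : ℂ) ^ k) := fun u => by ring
    simp_rw [this]
    rw [intervalIntegral.integral_const_mul, integral_cpow_mul_sub_cpow_mul_pow hc hs hy]
    simp only [hC]
    field_simp
  · intro k
    have h : IntervalIntegrable (fun u : ℝ => w u * (C c k * (u : ℂ) ^ k)) volume 0 y :=
      hw.mul_continuousOn (by fun_prop)
    exact (intervalIntegrable_iff.mp h).aestronglyMeasurable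
  · refine fun k => ae_of_all _ fun u hu => ?_
    obtain ⟨h0, h1⟩ := hmem u hu
    rw [norm_mul, norm_mul (C c k), norm_mul (C c k), norm_pow, norm_pow, Complex.norm_real,
      Complex.norm_real, Real.norm_of_nonneg h0.le, Real.norm_of_nonneg hy.le]
    gcongr
  · exact ae_of_all _ fun u _ => hsum.mul_left _
  · simp_rw [tsum_mul_left]
    exact hw.norm.mul_const _
  · refine ae_of_all _ fun u hu => ?_
    obtain ⟨h0, h1⟩ := hmem u hu
    refine (hasSum_regularizedGaussHGFun a b c ?_).mul_left _
    rw [Complex.norm_real, Real.norm_of_nonneg h0.le]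
    linarith

/-! ### The substitution `t = 1 - 2u` and the integral for a normalized sequence -/

theorem cutWeight_one_sub_two_mul {lam κ : ℂ} {y u : ℝ} (h0 : 0 < u) (h1 : u < y) (hy1 : y < 1) :
    cutWeight lam κ (1 - 2 * y) (1 - 2 * u) =
      2 ^ (2 * lam - κ - 3 / 2) * ((u : ℂ) ^ (lam + 1 / 2 - 1) * ((y : ℂ) - u) ^ (1 / 2 - κ - 1)) *
        (1 - (u : ℂ)) ^ (lam - 1 / 2) := by
  have e1 : ((1 - (1 - 2 * u) ^ 2 : ℝ) : ℂ) =
      ((2 : ℝ) : ℂ) * (((2 : ℝ) : ℂ) * ((u : ℂ) * ((1 - u : ℝ) : ℂ))) := by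
    push_cast; ring
  have e2 : ((1 - 2 * u - (1 - 2 * y) : ℝ) : ℂ) = ((2 : ℝ) : ℂ) * ((y - u : ℝ) : ℂ) := by
    push_cast; ring
  have hu1 : 0 ≤ 1 - u := by linarith
  have hyu : 0 ≤ y - u := by linarith
  have two : (2 : ℂ) ≠ 0 := two_ne_zero
  rw [cutWeight, e1, e2, Complex.mul_cpow_ofReal_nonneg two_pos.le hyu]
  rw [show ((2 : ℝ) : ℂ) * ((u : ℂ) * ((1 - u : ℝ) : ℂ)) = ((2 * (u * (1 - u)) : ℝ) : ℂ) by
      push_cast; ring, Complex.mul_cpow_ofReal_nonneg two_pos.le (by positivity),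
    Complex.ofReal_mul, Complex.mul_cpow_ofReal_nonneg two_pos.le (by positivity),
    Complex.ofReal_mul, Complex.mul_cpow_ofReal_nonneg h0.le hu1]
  rw [show 2 * lam - κ - 3 / 2 = (lam - 1 / 2) + (lam - 1 / 2) + (-κ - 1 / 2) by ring,
    Complex.cpow_add _ _ two, Complex.cpow_add _ _ two,
    show lam + 1 / 2 - 1 = lam - 1 / 2 by ring, show 1 / 2 - κ - 1 = -κ - 1 / 2 by ring]
  push_cast
  ring

theorem intervalIntegrable_cutWeight_mul {lam κ : ℂ} (hκ : κ.re < 1 / 2)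
    (hlam : -(1 / 2) < lam.re) {x : ℝ} (hx₁ : -1 < x) (hx₂ : x < 1) {p : ℝ → ℂ}
    (hp : Continuous p) :
    IntervalIntegrable (fun t : ℝ => cutWeight lam κ x t * p t) volume x 1 := by
  obtain ⟨y, rfl⟩ : ∃ y, x = 1 - 2 * y := ⟨(1 - x) / 2, by ring⟩
  have hy : 0 < y := by linarith
  have hy1 : y < 1 := by linarith
  have hc : 0 < (lam + 1 / 2).re := by simp at hlam ⊢; linarith
  have hs : 0 < (1 / 2 - κ).re := by simp at hκ ⊢; linarith
  refine IntervalIntegrable.mul_continuousOn ?_ hp.continuousOn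
  have h := (intervalIntegrable_cpow_mul_sub_cpow hc hs hy).const_mul (2 ^ (2 * lam - κ - 3 / 2))
  have hcont : ContinuousOn (fun u : ℝ => (1 - (u : ℂ)) ^ (lam - 1 / 2)) (Set.uIcc 0 y) := by
    refine ContinuousOn.cpow_const (by fun_prop) fun u hu => ?_
    rw [Set.uIcc_of_le hy.le] at hu
    rw [← Complex.ofReal_one, ← Complex.ofReal_sub, Complex.ofReal_mem_slitPlane]
    linarith [hu.2]
  have h' := ((h.mul_continuousOn hcont).congr_uIoo
    (g := fun u : ℝ => cutWeight lam κ (1 - 2 * y) (1 - 2 * u)) fun u hu => by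
      rw [Set.uIoo_of_le hy.le] at hu
      exact (cutWeight_one_sub_two_mul hu.1 hu.2 hy1).symm).comp_mul_left (c := 1 / 2)
  have h2 := h'.comp_sub_left 1
  -- The reflection `u = (1 - t) / 2` reverses the endpoints.
  refine IntervalIntegrable.symm ?_
  convert h2 using 1
  · ext t; congr 1; ring
  · ring
  · ring

theorem integral_cutWeight_mul {lam κ : ℂ} (hκ : κ.re < 1 / 2)
    (hlam : -(1 / 2) < lam.re) {x : ℝ} (hx₁ : -1 < x) (hx₂ : x < 1) (p : ℕ → ℂ → ℂ)
    (hp0 : ∀ t, p 0 t = 1) (hp1 : ∀ t, p 1 t = t)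
    (hp : ∀ (n : ℕ) (t : ℂ), (n + 1 + 2 * lam) * p (n + 2) t =
      2 * (n + 1 + lam) * t * p (n + 1) t - (n + 1) * p n t) (n : ℕ) :
    ∫ t : ℝ in x..1, cutWeight lam κ x t * p n t =
      2 ^ (lam - 1 / 2) * Complex.Gamma (lam + 1 / 2) * Complex.Gamma (1 / 2 - κ) *
        ((1 - x ^ 2 : ℝ) : ℂ) ^ ((lam - κ) / 2) * ferrersP (n + lam - 1 / 2) (κ - lam) x := by
  obtain ⟨y, rfl⟩ : ∃ y, x = 1 - 2 * y := ⟨(1 - x) / 2, by ring⟩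
  have hy : 0 < y := by linarith
  have hy1 : y < 1 := by linarith
  have hc : 0 < (lam + 1 / 2).re := by simp at hlam ⊢; linarith
  have hs : 0 < (1 / 2 - κ).re := by simp at hκ ⊢; linarith
  have two : (2 : ℂ) ≠ 0 := two_ne_zero
  have sub := intervalIntegral.smul_integral_comp_sub_mul (a := 0) (b := y)
    (fun t : ℝ => cutWeight lam κ (1 - 2 * y) t * p n t) 2 1
  rw [mul_zero, sub_zero] at sub
  have hint : ∫ u : ℝ in 0..y,
      cutWeight lam κ (1 - 2 * y) (1 - 2 * u) * p n ((1 - 2 * u : ℝ) : ℂ) =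
      2 ^ (2 * lam - κ - 3 / 2) * Complex.Gamma (lam + 1 / 2) *
      ∫ u : ℝ in 0..y, (u : ℂ) ^ (lam + 1 / 2 - 1) * ((y : ℂ) - u) ^ (1 / 2 - κ - 1) *
        Complex.regularizedGaussHGFun (lam + 1 / 2 + n) (1 / 2 - lam - n) (lam + 1 / 2) u := by
    rw [← intervalIntegral.integral_const_mul]
    refine intervalIntegral.integral_congr_Ioo_of_le hy.le fun u hu => ?_
    have hu1 : ‖(u : ℂ)‖ < 1 := by
      rw [Complex.norm_real, Real.norm_of_nonneg hu.1.le]; linarith [hu.2]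
    have := mul_cpow_eq_regularizedGaussHGFun hlam hu1 (fun n => p n (1 - 2 * u)) (hp0 _) (hp1 _)
      (fun n => hp n _) n
    simp only [cutWeight_one_sub_two_mul hu.1 hu.2 hy1]
    push_cast
    linear_combination (2 ^ (2 * lam - κ - 3 / 2) *
      ((u : ℂ) ^ (lam + 1 / 2 - 1) * ((y : ℂ) - u) ^ (1 / 2 - κ - 1))) * this
  -- With `r = (1 - y) / y`, the base `1 - x²` is `r (2y)²` and the Ferrers prefactor has base `r`;
  -- the powers of `r` cancel.
  have e1 : (((1 - (1 - 2 * y) ^ 2 : ℝ) : ℂ)) ^ ((lam - κ) / 2) *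
      (((1 + (1 - 2 * y)) / (1 - (1 - 2 * y)) : ℝ) : ℂ) ^ ((κ - lam) / 2) =
      2 ^ (lam - κ) * (y : ℂ) ^ (lam - κ) := by
    have h1 : 1 - (1 - 2 * y) ^ 2 = 4 * (1 - y) * y := by ring
    have h2 : (1 + (1 - 2 * y)) / (1 - (1 - 2 * y)) = ((1 - y) / y) := by
      field_simp; ring
    rw [h1, h2, show (κ - lam) / 2 = -((lam - κ) / 2) by ring,
      show (2 : ℂ) = ((2 : ℝ) : ℂ) by push_cast; rfl,
      ← Complex.mul_cpow_ofReal_nonneg two_pos.le hy.le]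
    have hb : (0 : ℝ) < (1 - y) / y := div_pos (by linarith) hy
    have hd : (0 : ℝ) < 2 * y := by positivity
    rw [show 4 * (1 - y) * y = ((1 - y) / y) * ((2 * y) * (2 * y)) by field_simp; ring,
      Complex.ofReal_mul, Complex.mul_cpow_ofReal_nonneg hb.le (by positivity), Complex.ofReal_mul,
      Complex.mul_cpow_ofReal_nonneg hd.le hd.le, mul_right_comm, ← Complex.cpow_add,
      ← Complex.cpow_add]
    · push_cast
      ring_nf
      simp
    · exact_mod_cast hd.ne'
    · exact_mod_cast hb.ne'
  rw [← sub, hint, integral_cpow_mul_regularizedGaussHGFun _ _ hc hs hy hy1, ferrersP,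
    show (1 - (1 - 2 * y)) / 2 = y by ring,
    show lam + 1 / 2 + (1 / 2 - κ) - 1 = lam - κ by ring,
    show lam + 1 / 2 + (1 / 2 - κ) = 1 - (κ - lam) by ring,
    show -(n + lam - 1 / 2) = 1 / 2 - lam - n by ring,
    show n + lam - 1 / 2 + 1 = lam + 1 / 2 + n by ring,
    Complex.regularizedGaussHGFun_symm (lam + 1 / 2 + n)]
  -- The factor `2` is the Jacobian of `t = 1 - 2u`.
  have e2 : (2 : ℂ) ^ (lam - 1 / 2) * 2 ^ (lam - κ) = 2 * 2 ^ (2 * lam - κ - 3 / 2) := by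
    rw [← Complex.cpow_add _ _ two,
      show lam - 1 / 2 + (lam - κ) = 1 + (2 * lam - κ - 3 / 2) by ring,
      Complex.cpow_add _ _ two, Complex.cpow_one]
  rw [Complex.real_smul]
  push_cast at e1 ⊢
  set R := Complex.regularizedGaussHGFun (1 / 2 - lam - n) (lam + 1 / 2 + n) (1 - (κ - lam)) y
  linear_combination (-(Complex.Gamma (lam + 1 / 2) * Complex.Gamma (1 / 2 - κ) * R *
    (y : ℂ) ^ (lam - κ))) * e2 - 2 ^ (lam - 1 / 2) * Complex.Gamma (lam + 1 / 2) *
    Complex.Gamma (1 / 2 - κ) * R * e1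

/-! ### Gegenbauer polynomials and their recurrence -/

/-- Padding with zeros frees the range from the parity of `n`, so that sums of different degrees can
be compared termwise. -/
theorem gegenbauerC_eq_sum_ite (n N : ℕ) (hN : n / 2 + 1 ≤ N) (lam t : ℂ) :
    gegenbauerC n lam t = ∑ k ∈ Finset.range N, if 2 * k ≤ n then
      (-1 : ℂ) ^ k * (ascPochhammer ℂ (n - k)).eval lam /
        ((Nat.factorial k : ℂ) * (Nat.factorial (n - 2 * k) : ℂ)) * (2 * t) ^ (n - 2 * k)
      else 0 := by
  rw [gegenbauerC, ← Finset.sum_filter]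
  refine Finset.sum_congr ?_ fun _ _ => rfl
  ext k
  simp only [Finset.mem_range, Finset.mem_filter]
  omega

theorem gegenbauerC_zero (lam t : ℂ) : gegenbauerC 0 lam t = 1 := by
  simp [gegenbauerC]

theorem gegenbauerC_one (lam t : ℂ) : gegenbauerC 1 lam t = 2 * lam * t := by
  simp [gegenbauerC]; ring

/-- The three-term recurrence of the Gegenbauer polynomials. -/
theorem gegenbauerC_add_two (n : ℕ) (lam t : ℂ) :
    (n + 2) * gegenbauerC (n + 2) lam t =
      2 * (n + 1 + lam) * t * gegenbauerC (n + 1) lam t - (n + 2 * lam) * gegenbauerC n lam t := by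
  rw [gegenbauerC_eq_sum_ite (n + 2) (n + 2 + 1) (by omega),
    gegenbauerC_eq_sum_ite (n + 1) (n + 2 + 1) (by omega),
    gegenbauerC_eq_sum_ite n (n + 2) (by omega), Finset.sum_range_succ' _ (n + 2),
    Finset.sum_range_succ' _ (n + 2), mul_add, mul_add, add_sub_right_comm, Finset.mul_sum,
    Finset.mul_sum, Finset.mul_sum, ← Finset.sum_sub_distrib]
  congr 1
  · refine Finset.sum_congr rfl fun k _ => ?_
    have hk : (Nat.factorial k : ℂ) ≠ 0 := by exact_mod_cast k.factorial_ne_zero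
    have hk1 : (k : ℂ) + 1 ≠ 0 := by exact_mod_cast k.succ_ne_zero
    -- Coefficient of `t^(n - 2k)`: void for `n < 2k`; for `n = 2k` the constant term, to which
    -- degree `n + 1` contributes nothing; otherwise generic.
    rcases lt_trichotomy n (2 * k) with h | rfl | h
    · rw [if_neg (by omega), if_neg (by omega), if_neg (by omega)]; ring
    · rw [if_pos (by omega), if_neg (by omega), if_pos (by omega),
        show 2 * k + 2 - (k + 1) = k + 1 by omega, show 2 * k + 2 - 2 * (k + 1) = 0 by omega,
        show 2 * k - k = k by omega, Nat.sub_self, ascPochhammer_succ_eval, Nat.factorial_succ]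
      push_cast
      field_simp
      ring
    · obtain ⟨j, rfl⟩ := Nat.exists_eq_add_of_lt h
      have hj : (Nat.factorial j : ℂ) ≠ 0 := by exact_mod_cast j.factorial_ne_zero
      have hj1 : (j : ℂ) + 1 ≠ 0 := by exact_mod_cast j.succ_ne_zero
      rw [if_pos (by omega), if_pos (by omega), if_pos (by omega),
        show 2 * k + j + 1 + 2 - (k + 1) = k + j + 1 + 1 by omega,
        show 2 * k + j + 1 + 2 - 2 * (k + 1) = j + 1 by omega,
        show 2 * k + j + 1 + 1 - (k + 1) = k + j + 1 by omega,
        show 2 * k + j + 1 + 1 - 2 * (k + 1) = j by omega,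
        show 2 * k + j + 1 - k = k + j + 1 by omega,
        show 2 * k + j + 1 - 2 * k = j + 1 by omega, ascPochhammer_succ_eval (k + j + 1),
        Nat.factorial_succ, Nat.factorial_succ]
      push_cast
      field_simp
      ring
  · have hn : (Nat.factorial (n + 1) : ℂ) ≠ 0 := by exact_mod_cast (n + 1).factorial_ne_zero
    have hn1 : (n : ℂ) + 1 + 1 ≠ 0 := by exact_mod_cast (n + 1).succ_ne_zero
    simp only [mul_zero, Nat.zero_le, if_true, Nat.sub_zero, pow_zero, Nat.factorial_zero,
      Nat.cast_one, one_mul]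
    rw [ascPochhammer_succ_eval (n + 1), Nat.factorial_succ (n + 1)]
    push_cast
    field_simp
    ring

theorem continuous_gegenbauerC (n : ℕ) (lam : ℂ) :
    Continuous fun t : ℝ => gegenbauerC n lam t := by
  unfold gegenbauerC
  fun_prop

/-! ### Limits as `λ → 0` -/

theorem tendsto_gegenbauerC_div (t : ℂ) (n : ℕ) :
    Tendsto (fun lam : ℂ => gegenbauerC (n + 1) lam t / lam) (𝓝[≠] 0)
      (𝓝 (2 / (n + 1) * (Polynomial.Chebyshev.T ℂ (n + 1 : ℕ)).eval t)) := by
  have hid : Tendsto (fun lam : ℂ => lam) (𝓝[≠] 0) (𝓝 0) :=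
    tendsto_nhdsWithin_of_tendsto_nhds tendsto_id
  have rec1 : ∀ n : ℕ, ∀ lam : ℂ, gegenbauerC (n + 2) lam t / lam =
      (2 * (n + 1 + lam) * t * (gegenbauerC (n + 1) lam t / lam) -
        (n + 2 * lam) * (gegenbauerC n lam t / lam)) / (n + 2) := fun n lam => by
    have hn : (n : ℂ) + 2 ≠ 0 := by exact_mod_cast (n + 1).succ_ne_zero
    rw [eq_div_iff hn]
    linear_combination gegenbauerC_add_two n lam t / lam
  have hT : ∀ n : ℕ, (Polynomial.Chebyshev.T ℂ (n + 2 : ℕ)).eval t =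
      2 * t * (Polynomial.Chebyshev.T ℂ (n + 1 : ℕ)).eval t -
        (Polynomial.Chebyshev.T ℂ n).eval t := fun n => by
    simp
  have h0 : Tendsto (fun lam : ℂ => gegenbauerC 1 lam t / lam) (𝓝[≠] 0) (𝓝 (2 * t)) := by
    refine tendsto_const_nhds.congr' ?_
    filter_upwards [self_mem_nhdsWithin] with lam hl
    have : lam ≠ 0 := hl
    rw [gegenbauerC_one]; field_simp
  induction n using Nat.twoStepInduction with
  | zero => simpa using h0
  | one =>
    -- `C_0 / λ` has no limit, but its coefficient in the recurrence is `2λ`, so the product is the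
    -- constant `2`.
    have h : Tendsto (fun lam : ℂ => (2 * (((0 : ℕ) : ℂ) + 1 + lam) * t *
        (gegenbauerC (0 + 1) lam t / lam) - 2) / (((0 : ℕ) : ℂ) + 2)) (𝓝[≠] 0)
        (𝓝 ((2 * (((0 : ℕ) : ℂ) + 1 + 0) * t * (2 * t) - 2) / (((0 : ℕ) : ℂ) + 2))) :=
      ((((hid.const_add _).const_mul 2).mul_const t).mul h0 |>.sub_const 2).div_const _
    have h2 := hT 0
    convert h.congr' ?_ using 2
    · rw [show 1 + 1 = 0 + 2 from rfl, h2]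
      simp
      ring
    · filter_upwards [self_mem_nhdsWithin] with lam hl
      have : lam ≠ 0 := hl
      rw [show 1 + 1 = 0 + 2 from rfl, rec1 0, gegenbauerC_zero]
      congr 1; push_cast; field_simp; ring
  | more n h1 h2 =>
    simp_rw [show n + 2 + 1 = n + 1 + 2 by ring, rec1 (n + 1)]
    have h := (((((hid.const_add (((n + 1 : ℕ) : ℂ) + 1)).const_mul 2).mul_const t).mul h2).sub
      (((hid.const_mul 2).const_add ((n + 1 : ℕ) : ℂ)).mul h1)).div_const (((n + 1 : ℕ) : ℂ) + 2)
    convert h using 2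
    rw [hT]
    have a1 : (n : ℂ) + 1 ≠ 0 := by exact_mod_cast n.succ_ne_zero
    have a2 : (n : ℂ) + 1 + 1 ≠ 0 := by exact_mod_cast (n + 1).succ_ne_zero
    have a3 : (n : ℂ) + 1 + 2 ≠ 0 := by exact_mod_cast (n + 2).succ_ne_zero
    have a4 : (n : ℂ) + 2 + 1 ≠ 0 := by exact_mod_cast (n + 2).succ_ne_zero
    push_cast
    field_simp
    ring

theorem tendsto_add_div_mul_gegenbauerC (n : ℕ) (t : ℂ) :
    Tendsto (fun lam : ℂ => (n + lam) / lam * gegenbauerC n lam t) (𝓝[≠] 0)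
      (𝓝 ((if n = 0 then 1 else 2) * (Polynomial.Chebyshev.T ℂ n).eval t)) := by
  have hid : Tendsto (fun lam : ℂ => lam) (𝓝[≠] 0) (𝓝 0) :=
    tendsto_nhdsWithin_of_tendsto_nhds tendsto_id
  rcases n with _ | n
  · refine tendsto_const_nhds.congr' ?_
    filter_upwards [self_mem_nhdsWithin] with lam hl
    have : lam ≠ 0 := hl
    simp [gegenbauerC_zero, this]
  · have h := (hid.const_add ((n + 1 : ℕ) : ℂ)).mul (tendsto_gegenbauerC_div t n)
    convert h using 2
    · ring
    · have a1 : (n : ℂ) + 1 ≠ 0 := by exact_mod_cast n.succ_ne_zero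
      rw [if_neg n.succ_ne_zero]
      push_cast
      field_simp
      ring

theorem tendsto_add_mul_Gamma_div (n : ℕ) :
    Tendsto (fun lam : ℂ => ((n : ℂ) + lam) * Complex.Gamma ((n : ℂ) + 2 * lam) /
        ((Nat.factorial n : ℂ) * Complex.Gamma (lam + 1))) (𝓝[≠] 0)
      (𝓝 (if n = 0 then 1 / 2 else 1)) := by
  have hG : ∀ m : ℕ, ContinuousAt Complex.Gamma (m + 1) := fun m =>
    (Complex.differentiableAt_Gamma _ fun k h => by
      have : ((m + 1 + k : ℕ) : ℂ) = 0 := by push_cast; rw [h]; ring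
      exact absurd (Nat.cast_eq_zero.mp this) (by omega)).continuousAt
  have h1 : ContinuousAt (fun lam : ℂ => Complex.Gamma (lam + 1)) 0 :=
    ContinuousAt.comp (g := Complex.Gamma) (by simpa using hG 0) (by fun_prop)
  have h2 : ∀ m : ℕ, ContinuousAt (fun lam : ℂ => Complex.Gamma (m + 1 + 2 * lam)) 0 := fun m =>
    ContinuousAt.comp (g := Complex.Gamma) (by simpa using hG m) (by fun_prop)
  rcases n with _ | n
  -- For `n = 0` the pole of `Γ(2λ)` is removed by `λ Γ(2λ) = Γ(1 + 2λ) / 2`, the source of the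
  -- value `1/2`.
  · have h : ContinuousAt (fun lam : ℂ => Complex.Gamma ((0 : ℕ) + 1 + 2 * lam) /
        (2 * Complex.Gamma (lam + 1))) 0 :=
      (h2 0).div (h1.const_mul 2) (by simp)
    have h' := h.tendsto.mono_left (nhdsWithin_le_nhds (s := {0}ᶜ))
    simp only [Nat.cast_zero, zero_add, mul_zero, add_zero, Complex.Gamma_one] at h'
    refine Tendsto.congr' ?_ (by simpa using h')
    filter_upwards [self_mem_nhdsWithin] with lam hl
    have : (2 * lam) ≠ 0 := mul_ne_zero two_ne_zero hl
    rw [add_comm 1, Complex.Gamma_add_one _ this]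
    simp
    ring
  · have h : ContinuousAt (fun lam : ℂ => (((n + 1 : ℕ) : ℂ) + lam) *
        Complex.Gamma (n + 1 + 2 * lam) /
        ((Nat.factorial (n + 1) : ℂ) * Complex.Gamma (lam + 1))) 0 :=
      ((continuousAt_id.const_add _).mul (h2 n)).div (h1.const_mul _)
        (by simpa using (n + 1).factorial_ne_zero)
    have h' := h.tendsto.mono_left (nhdsWithin_le_nhds (s := {0}ᶜ))
    push_cast at h' ⊢
    convert h' using 2
    have hn : (Nat.factorial n : ℂ) ≠ 0 := by exact_mod_cast n.factorial_ne_zero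
    have a1 : (n : ℂ) + 1 ≠ 0 := by exact_mod_cast n.succ_ne_zero
    rw [mul_zero, add_zero, zero_add, Complex.Gamma_one,
      Complex.Gamma_nat_eq_factorial, Nat.factorial_succ]
    push_cast
    field_simp

/-! ### The two cases of the formula -/

/-- The normalizing factor `n!/(2λ)_n` makes sense because `2λ` is not a nonpositive integer. The
constant follows from `(2λ)_n = Γ(n + 2λ)/Γ(2λ)` and Legendre's duplication formula. -/
theorem integral_cutWeight_mul_gegenbauerC (n : ℕ) {lam κ : ℂ} (hκ : κ.re < 1 / 2)
    (hlam : -(1 / 2) < lam.re) (h0 : lam ≠ 0) {x : ℝ} (hx₁ : -1 < x) (hx₂ : x < 1) :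
    ((n : ℂ) + lam) / lam * ∫ t in x..1, cutWeight lam κ x t * gegenbauerC n lam t =
        (Real.sqrt Real.pi : ℂ) * ((n : ℂ) + lam) * Complex.Gamma ((n : ℂ) + 2 * lam) *
            Complex.Gamma (1 / 2 - κ) /
          ((2 : ℂ) ^ (lam - 1 / 2) * (Nat.factorial n : ℂ) * Complex.Gamma (lam + 1)) *
          ((1 - x ^ 2 : ℝ) : ℂ) ^ ((lam - κ) / 2) *
          ferrersP ((n : ℂ) + lam - 1 / 2) (κ - lam) x := by
  have h2 : ∀ k : ℕ, 2 * lam ≠ -k := fun k h => by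
    rcases k with _ | k
    · exact h0 (by simpa using h)
    · have := congrArg Complex.re h
      simp at this hlam
      linarith [(Nat.cast_nonneg k : (0 : ℝ) ≤ k)]
  have hG : Complex.Gamma (2 * lam) ≠ 0 := Complex.Gamma_ne_zero h2
  have hfac : ∀ n : ℕ, (Nat.factorial n : ℂ) ≠ 0 := fun n => by exact_mod_cast n.factorial_ne_zero
  have hasc : ∀ n : ℕ, (ascPochhammer ℂ n).eval (2 * lam) ≠ 0 := fun n => by
    rw [← Complex.Gamma_add_nat_div_Gamma_eq _ h2]
    refine div_ne_zero (Complex.Gamma_ne_zero fun k h => h2 (n + k) ?_) hG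
    push_cast
    linear_combination h
  have key := integral_cutWeight_mul hκ hlam hx₁ hx₂
    (fun n t => (Nat.factorial n : ℂ) / (ascPochhammer ℂ n).eval (2 * lam) * gegenbauerC n lam t)
    (fun t => by simp [gegenbauerC_zero]) (fun t => by simp [gegenbauerC_one]; field_simp)
    (fun n t => by
      have e := gegenbauerC_add_two n lam t
      have e1 := ascPochhammer_succ_eval n (2 * lam)
      have e2 := ascPochhammer_succ_eval (n + 1) (2 * lam)
      have a0 := hasc n
      have a1 : 2 * lam + n ≠ 0 := right_ne_zero_of_mul (e1 ▸ hasc (n + 1))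
      have a2 := right_ne_zero_of_mul (e2 ▸ hasc (n + 2))
      push_cast at a2
      rw [e2, e1, Nat.factorial_succ (n + 1), Nat.factorial_succ n]
      push_cast
      field_simp
      linear_combination (Nat.factorial n : ℂ) * (2 * lam + (n + 1)) * e) n
  have h : ∀ t : ℝ, cutWeight lam κ x t * ((Nat.factorial n : ℂ) /
      (ascPochhammer ℂ n).eval (2 * lam) * gegenbauerC n lam t) = (Nat.factorial n : ℂ) /
      (ascPochhammer ℂ n).eval (2 * lam) * (cutWeight lam κ x t * gegenbauerC n lam t) :=
    fun t => by ring
  simp only [h] at key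
  rw [intervalIntegral.integral_const_mul] at key
  have hdup := Complex.Gamma_mul_Gamma_add_half lam
  have e2 : (2 : ℂ) ^ (1 - 2 * lam) * ((2 : ℂ) ^ (lam - 1 / 2) * (2 : ℂ) ^ (lam - 1 / 2)) = 1 := by
    rw [← Complex.cpow_add _ _ two_ne_zero, ← Complex.cpow_add _ _ two_ne_zero]
    ring_nf
    simp
  have hG0 : Complex.Gamma lam ≠ 0 := Complex.Gamma_ne_zero fun k h => h2 (2 * k) (by
    push_cast; linear_combination 2 * h)
  have h22 : (2 : ℂ) ^ (lam - 1 / 2) ≠ 0 := by simp [Complex.cpow_eq_zero_iff]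
  have hasc' := Complex.Gamma_add_nat_div_Gamma_eq (n := n) _ h2
  rw [div_eq_iff hG, add_comm] at hasc'
  have a := hasc n
  have f := hfac n
  rw [Complex.Gamma_add_one _ h0, hasc']
  have hI : ∫ t in x..1, cutWeight lam κ x t * gegenbauerC n lam t =
      (ascPochhammer ℂ n).eval (2 * lam) / (Nat.factorial n : ℂ) *
      (2 ^ (lam - 1 / 2) * Complex.Gamma (lam + 1 / 2) * Complex.Gamma (1 / 2 - κ) *
        ((1 - x ^ 2 : ℝ) : ℂ) ^ ((lam - κ) / 2) * ferrersP (n + lam - 1 / 2) (κ - lam) x) := by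
    rw [← key]; field_simp
  rw [hI]
  have hc : (2 : ℂ) ^ (lam - 1 / 2) * Complex.Gamma (lam + 1 / 2) =
      Real.sqrt Real.pi * Complex.Gamma (2 * lam) / (2 ^ (lam - 1 / 2) * Complex.Gamma lam) := by
    rw [eq_div_iff (mul_ne_zero h22 hG0)]
    linear_combination (2 : ℂ) ^ (lam - 1 / 2) * (2 : ℂ) ^ (lam - 1 / 2) * hdup +
      Complex.Gamma (2 * lam) * Real.sqrt Real.pi * e2
  rw [hc]
  field_simp

/-- At `λ = 0` the normalized recurrence is `n + 1` times that of `T_n`, and `Γ(λ + 1/2)` is `√π`.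
-/
theorem integral_cutWeight_mul_chebyshevT (n : ℕ) {κ : ℂ} (hκ : κ.re < 1 / 2)
    {x : ℝ} (hx₁ : -1 < x) (hx₂ : x < 1) :
    ∫ t in x..1, cutWeight 0 κ x t * (Polynomial.Chebyshev.T ℂ n).eval (t : ℂ) =
      (Real.sqrt Real.pi : ℂ) * (1 / 2) * Complex.Gamma (1 / 2 - κ) / (2 : ℂ) ^ (-(1 / 2) : ℂ) *
        ((1 - x ^ 2 : ℝ) : ℂ) ^ (-κ / 2) * ferrersP ((n : ℂ) - 1 / 2) κ x := by
  have key := integral_cutWeight_mul (lam := 0) hκ (by simp) hx₁ hx₂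
    (fun n t => (Polynomial.Chebyshev.T ℂ n).eval t) (by simp) (by simp) (fun n t => by
      have := congrArg (Polynomial.eval t) (Polynomial.Chebyshev.T_add_two ℂ n)
      simp only [Polynomial.eval_sub, Polynomial.eval_mul, Polynomial.eval_ofNat,
        Polynomial.eval_X] at this
      push_cast
      linear_combination (n + 1 : ℂ) * this) n
  have e2 : (2 : ℂ) ^ (-(1 / 2) : ℂ) * (2 : ℂ) ^ (-(1 / 2) : ℂ) = 1 / 2 := by
    rw [← Complex.cpow_add _ _ two_ne_zero, show -(1 / 2) + -(1 / 2) = (-1 : ℂ) by norm_num,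
      Complex.cpow_neg_one, one_div]
  have h22 : (2 : ℂ) ^ (-(1 / 2) : ℂ) ≠ 0 := by simp [Complex.cpow_eq_zero_iff]
  have hG : Complex.Gamma (1 / 2) = Real.sqrt Real.pi := by
    rw [Complex.Gamma_one_half_eq, Real.sqrt_eq_rpow, Complex.ofReal_cpow Real.pi_pos.le]
    norm_num
  have hc : (Real.sqrt Real.pi : ℂ) * (1 / 2) * Complex.Gamma (1 / 2 - κ) / (2 : ℂ) ^ (-(1 / 2) : ℂ)
      = (2 : ℂ) ^ (-(1 / 2) : ℂ) * Real.sqrt Real.pi * Complex.Gamma (1 / 2 - κ) := by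
    rw [div_eq_iff h22]
    linear_combination -Real.sqrt Real.pi * Complex.Gamma (1 / 2 - κ) * e2
  rw [key, hc]
  simp only [zero_add, zero_sub, add_zero, sub_zero, hG]

theorem mainTheorem1 (n : ℕ) (κ : ℂ) (hκ : κ.re < 1 / 2) (x : ℝ) (hx₁ : -1 < x) (hx₂ : x < 1) :
    -- the formula for `lam ≠ 0`
    (∀ lam : ℂ, -(1 / 2) < lam.re → lam ≠ 0 →
      IntervalIntegrable (fun t : ℝ => cutWeight lam κ x t * gegenbauerC n lam t) volume x 1 ∧
      ((n : ℂ) + lam) / lam * ∫ t in x..1, cutWeight lam κ x t * gegenbauerC n lam t =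
        (Real.sqrt Real.pi : ℂ) * ((n : ℂ) + lam) * Complex.Gamma ((n : ℂ) + 2 * lam) *
            Complex.Gamma (1 / 2 - κ) /
          ((2 : ℂ) ^ (lam - 1 / 2) * (Nat.factorial n : ℂ) * Complex.Gamma (lam + 1)) *
          ((1 - x ^ 2 : ℝ) : ℂ) ^ ((lam - κ) / 2) *
          ferrersP ((n : ℂ) + lam - 1 / 2) (κ - lam) x) ∧
    -- the formula for `lam = 0`, where the factors `(n + lam) / lam * C_n^lam(t)` and
    -- `(n + lam) Γ(n + 2 lam) / (n! Γ(lam + 1))` are replaced by their limits as `lam → 0`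
    (∀ t : ℝ, Tendsto (fun lam : ℂ => ((n : ℂ) + lam) / lam * gegenbauerC n lam t) (𝓝[≠] 0)
      (𝓝 ((if n = 0 then 1 else 2) * (Polynomial.Chebyshev.T ℂ n).eval (t : ℂ)))) ∧
    Tendsto (fun lam : ℂ => ((n : ℂ) + lam) * Complex.Gamma ((n : ℂ) + 2 * lam) /
        ((Nat.factorial n : ℂ) * Complex.Gamma (lam + 1))) (𝓝[≠] 0)
      (𝓝 (if n = 0 then 1 / 2 else 1)) ∧
    IntervalIntegrable (fun t : ℝ => cutWeight 0 κ x t *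
      ((if n = 0 then 1 else 2) * (Polynomial.Chebyshev.T ℂ n).eval (t : ℂ))) volume x 1 ∧
    ∫ t in x..1, cutWeight 0 κ x t *
        ((if n = 0 then 1 else 2) * (Polynomial.Chebyshev.T ℂ n).eval (t : ℂ)) =
      (Real.sqrt Real.pi : ℂ) * (if n = 0 then 1 / 2 else 1) * Complex.Gamma (1 / 2 - κ) /
          (2 : ℂ) ^ (-(1 / 2) : ℂ) *
        ((1 - x ^ 2 : ℝ) : ℂ) ^ (-κ / 2) * ferrersP ((n : ℂ) - 1 / 2) κ x := by
  refine ⟨fun lam hlam h0 => ⟨?_, ?_⟩, fun t => tendsto_add_div_mul_gegenbauerC n t,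
    tendsto_add_mul_Gamma_div n, ?_, ?_⟩
  · exact intervalIntegrable_cutWeight_mul hκ hlam hx₁ hx₂ (continuous_gegenbauerC n lam)
  · exact integral_cutWeight_mul_gegenbauerC n hκ hlam h0 hx₁ hx₂
  · exact intervalIntegrable_cutWeight_mul hκ (by simp) hx₁ hx₂ (by fun_prop)
  · simp_rw [mul_left_comm (cutWeight 0 κ x _)]
    rw [intervalIntegral.integral_const_mul, integral_cutWeight_mul_chebyshevT n hκ hx₁ hx₂]
    split_ifs <;> ring
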